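/- Let $\mathcal X\subset\mathbb R^d$, $\mathcal Y\subset\mathbb R$, and let $\rho$ be a probability measure on $\mathcal Z=\mathcal X\times\mathcal Y$. Let $K:\mathcal X\times\mathcal X\to\mathbb R$ be a Mercer kernel (continuous, symmetric, positive semi-definite) with $\kappa:=\sup_{x\in\mathcal X}\sqrt{K(x,x)}<\infty$, let $H_K$ be its reproducing kernel Hilbert space, and write $K_x=K(x,\cdot)$. Let $\alpha\in(0,1]$, $L>0$, and let $\phi:\mathcal Y\times\mathbb R\to[0,\infty)$ be a (measurable) loss function which is convex and differentiable in its second argument, with derivative $\phi'$ in that argument satisfying $$|\phi'(y,s)-\phi'(y,\tilde s)|\le L|s-\tilde s|^{\alpha}\qquad\text{for all } y\in\mathcal Y,\ s,\tilde s\in\mathbb R.$$ For $f:\mathcal X\to\mathbb R$ put $\mathcal E(f)=\int_{\mathcal Z}\phi(y,f(x))\,d\rho(x,y)$. Assume that $\mathcal E$ has a minimizer $f_H$ over $H_K$, and that $\sup_{y\in\mathcal Y}\phi(y,0)<\infty$ and $\sup_{(x,y)\in\mathcal Z}\phi(y,f_H(x))<\infty$. Let $z_t=(x_t,y_t)$,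 $t=1,2,\dots$, be independent random examples with law $\rho$, and let $$f_1=0,\qquad f_{t+1}=f_t-\eta_t\,\phi'(y_t,f_t(x_t))\,K_{x_t}\quad(t\ge1)$$ with step sizes $\eta_t=\eta_1t^{-\theta}$, where $0<\eta_1\le\frac1{A\kappa^2}$ (no upper bound on $\eta_1$ if $\kappa=0$) and $A=2\alpha^{\frac{1-\alpha}{1+\alpha}}L^{\frac{2}{1+\alpha}}(1+\alpha)$. If $\theta\in\left(\frac1{1+\alpha},1\right)$, then for every $\epsilon>0$, $$\lim_{t\to\infty}t^{\min\{1-\theta,\,(1+\alpha)\theta-1\}-\epsilon}\,\big(\mathcal E(f_t)-\mathcal E(f_H)\big)=0\quad\text{almost surely.}$$ Specifically, if $\theta=\frac{2}{2+\alpha}$, then for every $\epsilon>0$, $\lim_{t\to\infty}t^{\frac{\alpha}{2+\alpha}-\epsilon}\big(\mathcal E(f_t)-\mathcal E(f_H)\big)=0$ almost surely. -/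

import Mathlib

open MeasureTheory ProbabilityTheory Filter Topology

/-- The standing assumption on a loss `φ : 𝒴 × ℝ → [0, ∞)` with derivative in the second argument:
nonnegative, (jointly) measurable, convex and differentiable in the second argument, with
`(α, L)`-Hölder continuous derivative, uniformly in the first argument. -/
structure IsHolderLoss {Y : Type*} [MeasurableSpace Y] (φ : Y → ℝ → ℝ) (α L : ℝ) : Prop where
  measurable : Measurable (Function.uncurry φ)
  nonneg : ∀ y s, 0 ≤ φ y s
  convex : ∀ y, ConvexOn ℝ Set.univ (φ y)
  differentiable : ∀ y, Differentiable ℝ (φ y)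
  holder : ∀ y s s', |deriv (φ y) s - deriv (φ y) s'| ≤ L * |s - s'| ^ α

/-- The generalization error `ℰ(f) = ∫ φ(y, f(x)) dρ(x, y)`. -/
noncomputable def genError {X Y : Type*} [MeasurableSpace X] [MeasurableSpace Y]
    (φ : Y → ℝ → ℝ) (ρ : Measure (X × Y)) (f : X → ℝ) : ℝ :=
  ∫ z, φ z.2 (f z.1) ∂ρ

/-- Online gradient descent in the RKHS `H`, driven by step sizes `η 1, η 2, …` and examples
`z 1, z 2, …`: `f 1 = 0` and `f (t + 1) = f t - η t * φ'(y t, f t (x t)) • K_{x t}` for `t ≥ 1`,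
where `K_x = RKHS.kerFun H x 1`. The entry with index `0` is a dummy. -/
noncomputable def onlineGD {X Y : Type*} (H : Type*) [NormedAddCommGroup H]
    [InnerProductSpace ℝ H] [CompleteSpace H] [RKHS ℝ H X ℝ]
    (φ : Y → ℝ → ℝ) (η : ℕ → ℝ) (z : ℕ → X × Y) : ℕ → H
  | 0 => 0
  | 1 => 0
  | t + 2 =>
      onlineGD H φ η z (t + 1)
        - (η (t + 1) * deriv (φ (z (t + 1)).2) (onlineGD H φ η z (t + 1) (z (t + 1)).1)) •
            RKHS.kerFun H (z (t + 1)).1 (1 : ℝ)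

/-- The random variables `z 1, z 2, …` are independent with common law `ρ`
(nothing is required of `z 0`). -/
structure IsIIDSample {Ω Z : Type*} [MeasurableSpace Ω] [MeasurableSpace Z]
    (z : ℕ → Ω → Z) (ρ : Measure Z) (P : Measure Ω) : Prop where
  measurable : ∀ t, Measurable (z (t + 1))
  law : ∀ t, P.map (z (t + 1)) = ρ
  indep : iIndepFun (fun t : ℕ => z (t + 1)) P

/-- `κ = sup_x √K(x, x)`. -/
noncomputable def kernelBound {X : Type*} (K : X → X → ℝ) : ℝ := ⨆ x, √(K x x)

/-- The constant `A = 2 α^((1 - α)/(1 + α)) L^(2/(1 + α)) (1 + α)`. -/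
noncomputable def selfBoundConst (α L : ℝ) : ℝ :=
  2 * α ^ ((1 - α) / (1 + α)) * L ^ (2 / (1 + α)) * (1 + α)

/-- Polynomially decaying step sizes `η t = η₁ t^(-θ)`. -/
noncomputable def polyStep (η₁ θ : ℝ) (t : ℕ) : ℝ := η₁ * (t : ℝ) ^ (-θ)

/-! Write `D t` for the excess error of the `t`-th iterate. The proof combines two one-step
estimates, averaged over a fresh example. Distance (`integral_norm_gdStep_sub_sq_le`): convexity
makes the squared distance to the minimizer decrease by `2 η D`, up to an error of order `η ^ 2 (D +
const)`. Since `θ > 1/2`, the squared steps are summable, and telescoping expectations gives `∑ η t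
* E[D t] < ∞` (`summable_integral_excess`). Error (`integral_genError_gdStep_le`): Hölder smoothness
shows that one step raises the conditional mean of `D` by at most `C η ^ (1 + α) (D + const)`.
Weight the second estimate by `t ^ p`. The increment of the weight costs `t ^ (p - 1) D`, whose mean
is summable by the first estimate when `p ≤ 1 - θ`; the smoothness error costs `t ^ (p - (1 + α)
θ)`, summable when `p < (1 + α) θ - 1`. A nonnegative process with summable mean drift is almost
surely bounded (`ae_bounded_of_setIntegral_succ_le`), so `t ^ p D t` is bounded. Taking `p` slightly
below the critical exponent yields the limit. -/

/-! ### Pointwise estimates for a Hölder-smooth convex loss. -/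

namespace IsHolderLoss

variable {Y : Type*} [MeasurableSpace Y] {φ : Y → ℝ → ℝ} {α L : ℝ}

theorem deriv_mul_sub_le (hφ : IsHolderLoss φ α L) (y : Y) (s s' : ℝ) :
    deriv (φ y) s * (s' - s) ≤ φ y s' - φ y s := by
  have hd := (hφ.differentiable y s).hasDerivAt
  rcases lt_trichotomy s s' with h | rfl | h
  · have := (hφ.convex y).le_slope_of_hasDerivAt (Set.mem_univ _) (Set.mem_univ _) h hd
    rwa [slope_def_field, le_div_iff₀ (sub_pos.2 h)] at this
  · simp
  · have := (hφ.convex y).slope_le_of_hasDerivAt (Set.mem_univ _) (Set.mem_univ _) h hd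
    rw [slope_def_field, div_le_iff₀ (sub_pos.2 h)] at this
    linarith

theorem le_add_deriv_mul_add (hφ : IsHolderLoss φ α L) (hα : 0 < α) (y : Y) (s s' : ℝ) :
    φ y s' ≤ φ y s + deriv (φ y) s * (s' - s) + L * |s' - s| ^ (1 + α) := by
  have h1 := hφ.deriv_mul_sub_le y s' s
  have h2 : (deriv (φ y) s' - deriv (φ y) s) * (s' - s) ≤ L * |s' - s| ^ (1 + α) := by
    calc _ ≤ |deriv (φ y) s' - deriv (φ y) s| * |s' - s| := by
          rw [← abs_mul]; exact le_abs_self _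
      _ ≤ L * |s' - s| ^ α * |s' - s| := by gcongr; exact hφ.holder y s' s
      _ = L * |s' - s| ^ (1 + α) := by
          rw [add_comm, Real.rpow_add_one' (abs_nonneg _) (by positivity), mul_assoc]
  linarith

theorem rpow_one_add_le {a : ℝ} (ha : 0 ≤ a) (hα₀ : 0 < α) (hα₁ : α ≤ 1) :
    a ^ (1 + α) ≤ 1 + a ^ 2 := by
  rcases le_total a 1 with h | h
  · have := Real.rpow_le_one ha h (by positivity : 0 ≤ 1 + α)
    nlinarith [sq_nonneg a]
  · have := Real.rpow_le_rpow_of_exponent_le h (by linarith : 1 + α ≤ 2)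
    rw [Real.rpow_two] at this
    linarith

/-- A coarse self-bounding property: the smoothness bound at the trial point `s - u / (2 * L)` must
stay nonnegative. Replacing the power `1 + α` by `1 + a ^ 2` makes the optimization quadratic, at
the price of the additive `L`. -/
theorem deriv_sq_le (hφ : IsHolderLoss φ α L) (hα₀ : 0 < α) (hα₁ : α ≤ 1) (hL : 0 < L)
    (y : Y) (s : ℝ) : deriv (φ y) s ^ 2 ≤ 4 * L * (φ y s + L) := by
  set u := deriv (φ y) s
  have h1 := hφ.le_add_deriv_mul_add hα₀ y s (s - u / (2 * L))
  have h2 := hφ.nonneg y (s - u / (2 * L))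
  have h3 := rpow_one_add_le (abs_nonneg (u / (2 * L))) hα₀ hα₁
  rw [sq_abs] at h3
  rw [show s - u / (2 * L) - s = -(u / (2 * L)) by ring, abs_neg] at h1
  have h4 := mul_le_mul_of_nonneg_left h3 hL.le
  have h5 : u * -(u / (2 * L)) + L * (1 + (u / (2 * L)) ^ 2) = L - u ^ 2 / (4 * L) := by
    field_simp; ring
  have h6 : u ^ 2 / (4 * L) ≤ φ y s + L := by linarith
  rw [div_le_iff₀ (by positivity)] at h6
  linarith

theorem abs_deriv_rpow_le (hφ : IsHolderLoss φ α L) (hα₀ : 0 < α) (hα₁ : α ≤ 1) (hL : 0 < L)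
    (y : Y) (s : ℝ) : |deriv (φ y) s| ^ (1 + α) ≤ 1 + 4 * L * (φ y s + L) := by
  have h := rpow_one_add_le (abs_nonneg (deriv (φ y) s)) hα₀ hα₁
  rw [sq_abs] at h
  linarith [hφ.deriv_sq_le hα₀ hα₁ hL y s]

/-- Uniformity in `y` is what makes each iterate deterministically bounded, hence all later
integrands bounded. -/
theorem exists_bound (hφ : IsHolderLoss φ α L) (hα₀ : 0 < α) (hα₁ : α ≤ 1) (hL : 0 < L)
    (hM : BddAbove (Set.range fun y => φ y 0)) (R : ℝ) :
    ∃ C, 0 ≤ C ∧ ∀ y s, |s| ≤ R → φ y s ≤ C ∧ |deriv (φ y) s| ≤ C := by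
  obtain ⟨M, hM⟩ := hM
  replace hM : ∀ y, φ y 0 ≤ M := fun y => hM ⟨y, rfl⟩
  set C₁ := |M| + 2 * L * (|M| + L) + R ^ 2 / 2 + L * (1 + R ^ 2)
  have hC₁ : 0 ≤ C₁ := by positivity
  have h1 : ∀ y s, |s| ≤ R → φ y s ≤ C₁ := by
    intro y s hs
    have a1 := hφ.le_add_deriv_mul_add hα₀ y 0 s
    have a2 := hφ.deriv_sq_le hα₀ hα₁ hL y 0
    have a3 := rpow_one_add_le (abs_nonneg s) hα₀ hα₁
    rw [sub_zero] at a1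
    have a4 := mul_le_mul_of_nonneg_left a3 hL.le
    have a5 : |s| ^ 2 ≤ R ^ 2 := by gcongr
    have a6 : φ y 0 ≤ |M| := (hM y).trans (le_abs_self _)
    rw [sq_abs] at a4 a5
    have a7 : deriv (φ y) 0 * s ≤ deriv (φ y) 0 ^ 2 / 2 + s ^ 2 / 2 := by
      nlinarith [sq_nonneg (deriv (φ y) 0 - s)]
    have a8 := mul_le_mul_of_nonneg_left a5 hL.le
    have a9 := mul_le_mul_of_nonneg_left a6 hL.le
    simp only [C₁]
    linarith
  refine ⟨C₁ + (1 + 4 * L * (C₁ + L)), by positivity, fun y s hs => ⟨?_, ?_⟩⟩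
  · have := h1 y s hs
    have : 0 ≤ 1 + 4 * L * (C₁ + L) := by positivity
    linarith [h1 y s hs]
  · have a1 := hφ.deriv_sq_le hα₀ hα₁ hL y s
    have a2 := mul_le_mul_of_nonneg_left (h1 y s hs) hL.le
    have a3 : |deriv (φ y) s| ≤ 1 + deriv (φ y) s ^ 2 := by
      rw [← sq_abs]; nlinarith [sq_nonneg (|deriv (φ y) s| - 1)]
    linarith

/-- The derivative is the pointwise limit of difference quotients with increment `1 / (n + 1)`, each
jointly measurable. -/
theorem measurable_deriv (hφ : IsHolderLoss φ α L) :
    Measurable fun p : Y × ℝ => deriv (φ p.1) p.2 := by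
  refine measurable_of_tendsto_metrizable
    (f := fun (n : ℕ) (p : Y × ℝ) =>
      ((1 : ℝ) / ((n : ℝ) + 1))⁻¹ * (φ p.1 (p.2 + 1 / ((n : ℝ) + 1)) - φ p.1 p.2)) ?_ ?_
  · intro n
    refine Measurable.const_mul (Measurable.sub ?_ ?_) _
    · exact hφ.measurable.comp (measurable_fst.prodMk (measurable_snd.add_const _))
    · exact hφ.measurable
  · rw [tendsto_pi_nhds]
    rintro ⟨y, s⟩
    have h := (hφ.differentiable y s).hasDerivAt.tendsto_slope_zero
    refine h.comp (tendsto_nhdsWithin_iff.2 ⟨tendsto_one_div_add_atTop_nhds_zero_nat, ?_⟩)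
    exact Eventually.of_forall fun n => by simp; positivity

end IsHolderLoss

open scoped InnerProductSpace

theorem genError_nonneg {X Y : Type*} [MeasurableSpace X] [MeasurableSpace Y] {φ : Y → ℝ → ℝ}
    {α L : ℝ} (hφ : IsHolderLoss φ α L) (ρ : Measure (X × Y)) (f : X → ℝ) :
    0 ≤ genError φ ρ f :=
  integral_nonneg fun _ => hφ.nonneg _ _

/-! ### One gradient step in the RKHS: pointwise, measurability and averaged estimates. -/

section GradientStep

variable {X Y : Type*} {H : Type*} [NormedAddCommGroup H] [InnerProductSpace ℝ H]
  [CompleteSpace H] [RKHS ℝ H X ℝ] {φ : Y → ℝ → ℝ} {α L κ : ℝ}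

theorem RKHS.apply_eq_inner (f : H) (x : X) : f x = ⟪f, RKHS.kerFun H x (1 : ℝ)⟫_ℝ := by
  simp [RKHS.inner_kerFun]

theorem RKHS.abs_apply_le (hκ : ∀ x : X, ‖RKHS.kerFun H x (1 : ℝ)‖ ≤ κ) (f : H) (x : X) :
    |f x| ≤ ‖f‖ * κ := by
  rw [RKHS.apply_eq_inner]
  exact (abs_real_inner_le_norm _ _).trans (by gcongr; exact hκ x)

/-- One step of online gradient descent with step size `c` at the example `z`. -/
noncomputable def gdStep (φ : Y → ℝ → ℝ) (c : ℝ) (f : H) (z : X × Y) : H :=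
  f - (c * deriv (φ z.2) (f z.1)) • RKHS.kerFun H z.1 (1 : ℝ)

theorem norm_gdStep_le (hκ : ∀ x : X, ‖RKHS.kerFun H x (1 : ℝ)‖ ≤ κ) {c C R : ℝ} (f : H)
    (z : X × Y) (hf : ‖f‖ ≤ R) (hC : |deriv (φ z.2) (f z.1)| ≤ C) :
    ‖gdStep φ c f z‖ ≤ R + |c| * C * κ := by
  have hC' : 0 ≤ C := (abs_nonneg _).trans hC
  refine (norm_sub_le _ _).trans (add_le_add hf ?_)
  rw [norm_smul, Real.norm_eq_abs, abs_mul]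
  gcongr
  exact hκ _

variable [MeasurableSpace Y]

/-- Expand the square: by the reproducing property the cross term is a derivative times `h x - f x`,
controlled by convexity; `deriv_sq_le` controls the quadratic term. -/
theorem norm_gdStep_sub_sq_le (hφ : IsHolderLoss φ α L) (hα₀ : 0 < α) (hα₁ : α ≤ 1) (hL : 0 < L)
    (hκ : ∀ x : X, ‖RKHS.kerFun H x (1 : ℝ)‖ ≤ κ) {c : ℝ} (hc : 0 ≤ c) (f h : H) (z : X × Y) :
    ‖gdStep φ c f z - h‖ ^ 2 ≤ ‖f - h‖ ^ 2 + 2 * c * (φ z.2 (h z.1) - φ z.2 (f z.1))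
      + c ^ 2 * κ ^ 2 * (4 * L * (φ z.2 (f z.1) + L)) := by
  set u := deriv (φ z.2) (f z.1) with hu
  have e1 : gdStep φ c f z - h = (f - h) - (c * u) • RKHS.kerFun H z.1 (1 : ℝ) := by
    simp only [gdStep, hu]; abel
  rw [e1, norm_sub_sq_real, inner_smul_right, ← RKHS.apply_eq_inner, RKHS.coe_sub, Pi.sub_apply,
    norm_smul, mul_pow, Real.norm_eq_abs, sq_abs]
  have h1 := hφ.deriv_mul_sub_le z.2 (f z.1) (h z.1)
  have h2 := hφ.deriv_sq_le hα₀ hα₁ hL z.2 (f z.1)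
  have h3 : ‖RKHS.kerFun H z.1 (1 : ℝ)‖ ^ 2 ≤ κ ^ 2 := by gcongr; exact hκ _
  have h4 : u ^ 2 * ‖RKHS.kerFun H z.1 (1 : ℝ)‖ ^ 2 ≤ 4 * L * (φ z.2 (f z.1) + L) * κ ^ 2 :=
    mul_le_mul h2 h3 (by positivity) ((sq_nonneg _).trans h2)
  have h5 := mul_le_mul_of_nonneg_left h4 (sq_nonneg c)
  have h6 := mul_le_mul_of_nonneg_left h1 hc
  linarith

variable [TopologicalSpace X] [SecondCountableTopology X] [MeasurableSpace X]
  [OpensMeasurableSpace X]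

section Measurability

variable {W : Type*} [MeasurableSpace W]

theorem stronglyMeasurable_kerFun_comp (hK : Continuous fun x : X => RKHS.kerFun H x (1 : ℝ))
    {G : W → X} (hG : Measurable G) :
    StronglyMeasurable fun w => RKHS.kerFun H (G w) (1 : ℝ) :=
  hK.stronglyMeasurable.comp_measurable hG

theorem measurable_rkhs_apply (hK : Continuous fun x : X => RKHS.kerFun H x (1 : ℝ))
    {F : W → H} {G : W → X} (hF : StronglyMeasurable F) (hG : Measurable G) :
    Measurable fun w => F w (G w) := by
  simp_rw [RKHS.apply_eq_inner]
  exact (hF.inner (stronglyMeasurable_kerFun_comp hK hG)).measurable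

theorem measurable_loss_comp (hφ : IsHolderLoss φ α L)
    (hK : Continuous fun x : X => RKHS.kerFun H x (1 : ℝ))
    {F : W → H} {G : W → X × Y} (hF : StronglyMeasurable F) (hG : Measurable G) :
    Measurable fun w => φ (G w).2 (F w (G w).1) :=
  hφ.measurable.comp (hG.snd.prodMk (measurable_rkhs_apply hK hF hG.fst))

theorem measurable_deriv_comp (hφ : IsHolderLoss φ α L)
    (hK : Continuous fun x : X => RKHS.kerFun H x (1 : ℝ))
    {F : W → H} {G : W → X × Y} (hF : StronglyMeasurable F) (hG : Measurable G) :
    Measurable fun w => deriv (φ (G w).2) (F w (G w).1) :=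
  hφ.measurable_deriv.comp (hG.snd.prodMk (measurable_rkhs_apply hK hF hG.fst))

theorem stronglyMeasurable_gdStep (hφ : IsHolderLoss φ α L)
    (hK : Continuous fun x : X => RKHS.kerFun H x (1 : ℝ)) (c : ℝ)
    {F : W → H} {G : W → X × Y} (hF : StronglyMeasurable F) (hG : Measurable G) :
    StronglyMeasurable fun w => gdStep φ c (F w) (G w) :=
  hF.sub (((measurable_deriv_comp hφ hK hF hG).const_mul c).stronglyMeasurable.smul
    (stronglyMeasurable_kerFun_comp hK hG.fst))

theorem stronglyMeasurable_genError (hφ : IsHolderLoss φ α L)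
    (hK : Continuous fun x : X => RKHS.kerFun H x (1 : ℝ)) (ρ : Measure (X × Y)) [SFinite ρ]
    {F : W → H} (hF : StronglyMeasurable F) :
    StronglyMeasurable fun w => genError φ ρ (F w) := by
  have : StronglyMeasurable fun p : W × (X × Y) => φ p.2.2 (F p.1 p.2.1) :=
    (measurable_loss_comp hφ hK (hF.comp_measurable measurable_fst)
      measurable_snd).stronglyMeasurable
  exact this.integral_prod_right

end Measurability

variable {ρ : Measure (X × Y)} [IsProbabilityMeasure ρ]

theorem integrable_loss (hφ : IsHolderLoss φ α L) (hα₀ : 0 < α) (hα₁ : α ≤ 1) (hL : 0 < L)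
    (hM : BddAbove (Set.range fun y => φ y 0))
    (hK : Continuous fun x : X => RKHS.kerFun H x (1 : ℝ))
    (hκ : ∀ x : X, ‖RKHS.kerFun H x (1 : ℝ)‖ ≤ κ) (f : H) :
    Integrable (fun z => φ z.2 (f z.1)) ρ := by
  obtain ⟨C, -, hC⟩ := hφ.exists_bound hα₀ hα₁ hL hM (‖f‖ * κ)
  refine Integrable.of_bound (C := C)
    (measurable_loss_comp hφ hK stronglyMeasurable_const measurable_id).aestronglyMeasurable
    (Eventually.of_forall fun z => ?_)
  rw [Real.norm_eq_abs, abs_of_nonneg (hφ.nonneg _ _)]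
  exact (hC _ _ (RKHS.abs_apply_le hκ f _)).1

theorem exists_genError_le (hφ : IsHolderLoss φ α L) (hα₀ : 0 < α) (hα₁ : α ≤ 1) (hL : 0 < L)
    (hM : BddAbove (Set.range fun y => φ y 0))
    (hK : Continuous fun x : X => RKHS.kerFun H x (1 : ℝ))
    (hκ : ∀ x : X, ‖RKHS.kerFun H x (1 : ℝ)‖ ≤ κ) (hκ₀ : 0 ≤ κ) (R : ℝ) :
    ∃ C, ∀ f : H, ‖f‖ ≤ R → genError φ ρ f ≤ C := by
  obtain ⟨C, -, hC⟩ := hφ.exists_bound hα₀ hα₁ hL hM (R * κ)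
  refine ⟨C, fun f hf => ?_⟩
  calc genError φ ρ f ≤ ∫ _, C ∂ρ :=
        integral_mono (integrable_loss hφ hα₀ hα₁ hL hM hK hκ f) (integrable_const _) fun z =>
          (hC _ _ ((RKHS.abs_apply_le hκ f _).trans (by gcongr))).1
    _ = C := by simp

theorem integral_norm_gdStep_sub_sq_le (hφ : IsHolderLoss φ α L) (hα₀ : 0 < α) (hα₁ : α ≤ 1)
    (hL : 0 < L) (hM : BddAbove (Set.range fun y => φ y 0))
    (hK : Continuous fun x : X => RKHS.kerFun H x (1 : ℝ))
    (hκ : ∀ x : X, ‖RKHS.kerFun H x (1 : ℝ)‖ ≤ κ) {c : ℝ} (hc : 0 ≤ c) (f h : H) :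
    ∫ z, ‖gdStep φ c f z - h‖ ^ 2 ∂ρ ≤
      ‖f - h‖ ^ 2 + 2 * c * (genError φ ρ h - genError φ ρ f)
        + c ^ 2 * κ ^ 2 * (4 * L * (genError φ ρ f + L)) := by
  have hif := integrable_loss (ρ := ρ) hφ hα₀ hα₁ hL hM hK hκ f
  have hih := integrable_loss (ρ := ρ) hφ hα₀ hα₁ hL hM hK hκ h
  have i1 : Integrable (fun z => 2 * c * (φ z.2 (h z.1) - φ z.2 (f z.1))) ρ :=
    (hih.sub hif).const_mul _
  have i2 : Integrable (fun z => c ^ 2 * κ ^ 2 * (4 * L * (φ z.2 (f z.1) + L))) ρ :=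
    ((hif.add (integrable_const L)).const_mul _).const_mul _
  have i3 : Integrable (fun z => ‖f - h‖ ^ 2 + 2 * c * (φ z.2 (h z.1) - φ z.2 (f z.1))) ρ :=
    (integrable_const _).add i1
  calc _ ≤ ∫ z, (‖f - h‖ ^ 2 + 2 * c * (φ z.2 (h z.1) - φ z.2 (f z.1))
      + c ^ 2 * κ ^ 2 * (4 * L * (φ z.2 (f z.1) + L))) ∂ρ :=
        integral_mono_of_nonneg (Eventually.of_forall fun z => sq_nonneg _) (i3.add i2)
          (Eventually.of_forall fun z => norm_gdStep_sub_sq_le hφ hα₀ hα₁ hL hκ hc f h z)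
    _ = _ := by
        rw [integral_add i3 i2, integral_add (integrable_const _) i1, integral_const_mul,
          integral_const_mul, integral_const_mul, integral_sub hih hif,
          integral_add hif (integrable_const _)]
        simp [genError]

/-- To first order the mean change is `-c ‖G‖ ^ 2 ≤ 0`, where `G` is the mean gradient, so only the
Hölder remainder survives. -/
theorem integral_genError_gdStep_le (hφ : IsHolderLoss φ α L) (hα₀ : 0 < α) (hα₁ : α ≤ 1)
    (hL : 0 < L) (hM : BddAbove (Set.range fun y => φ y 0))
    (hK : Continuous fun x : X => RKHS.kerFun H x (1 : ℝ))
    (hκ : ∀ x : X, ‖RKHS.kerFun H x (1 : ℝ)‖ ≤ κ) (hκ₀ : 0 ≤ κ) {c : ℝ} (hc : 0 ≤ c) (f : H) :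
    ∫ z, genError φ ρ (gdStep φ c f z : H) ∂ρ ≤
      genError φ ρ f
        + L * (c * κ ^ 2) ^ (1 + α) * (1 + 4 * L * (genError φ ρ f + L)) := by
  have hif := integrable_loss (ρ := ρ) hφ hα₀ hα₁ hL hM hK hκ f
  obtain ⟨C, hC₀, hC⟩ := hφ.exists_bound hα₀ hα₁ hL hM (‖f‖ * κ)
  set u : X × Y → ℝ := fun z => deriv (φ z.2) (f z.1) with hu
  have hum : Measurable u := measurable_deriv_comp hφ hK stronglyMeasurable_const measurable_id
  have huC : ∀ z, |u z| ≤ C := fun z => (hC _ _ (RKHS.abs_apply_le hκ f _)).2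
  set v : X × Y → H := fun z => u z • RKHS.kerFun H z.1 (1 : ℝ) with hv
  have hvi : Integrable v ρ := by
    refine Integrable.of_bound (C := C * κ) (hum.stronglyMeasurable.smul
      (stronglyMeasurable_kerFun_comp hK measurable_fst)).aestronglyMeasurable
      (Eventually.of_forall fun z => ?_)
    rw [norm_smul, Real.norm_eq_abs]
    exact mul_le_mul (huC z) (hκ _) (norm_nonneg _) hC₀
  set G : H := ∫ z, v z ∂ρ with hG
  set B := L * (c * κ ^ 2) ^ (1 + α) with hB
  have hB₀ : 0 ≤ B := by positivity
  have hpt : ∀ z, genError φ ρ (gdStep φ c f z : H) ≤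
      genError φ ρ f - c * ⟪G, v z⟫_ℝ + B * (1 + 4 * L * (φ z.2 (f z.1) + L)) := by
    intro z
    have hdiff : ∀ x', gdStep φ c f z x' - f x' =
        -(c * ⟪v z, RKHS.kerFun H x' (1 : ℝ)⟫_ℝ) := by
      intro x'
      simp only [gdStep, RKHS.coe_sub, Pi.sub_apply, RKHS.coe_smul, Pi.smul_apply, hv,
        ← RKHS.apply_eq_inner, hu, smul_eq_mul]
      ring
    -- Smoothness at a test example `z'`, independent of the training example `z`; integrating over
    -- `z'` turns `v z'` into `G`.
    have hle : ∀ z' : X × Y, φ z'.2 (gdStep φ c f z z'.1) ≤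
        φ z'.2 (f z'.1) - c * ⟪v z, v z'⟫_ℝ + B * (1 + 4 * L * (φ z.2 (f z.1) + L)) := by
      intro z'
      have h1 := hφ.le_add_deriv_mul_add hα₀ z'.2 (f z'.1) (gdStep φ c f z z'.1)
      rw [hdiff] at h1
      have h2 : deriv (φ z'.2) (f z'.1) * -(c * ⟪v z, RKHS.kerFun H z'.1 (1 : ℝ)⟫_ℝ) =
          -(c * ⟪v z, v z'⟫_ℝ) := by
        simp only [hv, inner_smul_right, hu]; ring
      have h3 : |-(c * ⟪v z, RKHS.kerFun H z'.1 (1 : ℝ)⟫_ℝ)| ≤ c * κ ^ 2 * |u z| := by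
        rw [abs_neg, abs_mul, abs_of_nonneg hc, mul_assoc]
        gcongr
        refine (abs_real_inner_le_norm _ _).trans ?_
        rw [norm_smul, Real.norm_eq_abs]
        calc _ ≤ |u z| * κ * κ := by gcongr <;> exact hκ _
          _ = _ := by ring
      have h4 : L * |-(c * ⟪v z, RKHS.kerFun H z'.1 (1 : ℝ)⟫_ℝ)| ^ (1 + α) ≤
          B * (1 + 4 * L * (φ z.2 (f z.1) + L)) := by
        calc _ ≤ L * (c * κ ^ 2 * |u z|) ^ (1 + α) := by gcongr
          _ = B * |u z| ^ (1 + α) := by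
            rw [Real.mul_rpow (by positivity) (abs_nonneg _), hB]; ring
          _ ≤ _ := by gcongr; exact hφ.abs_deriv_rpow_le hα₀ hα₁ hL _ _
      linarith
    have i1 : Integrable (fun z' => c * ⟪v z, v z'⟫_ℝ) ρ := (hvi.const_inner _).const_mul _
    have i2 : Integrable (fun z' : X × Y => φ z'.2 (f z'.1) - c * ⟪v z, v z'⟫_ℝ) ρ := hif.sub i1
    calc genError φ ρ (gdStep φ c f z : H) ≤ ∫ z' : X × Y, (φ z'.2 (f z'.1) - c * ⟪v z, v z'⟫_ℝ
          + B * (1 + 4 * L * (φ z.2 (f z.1) + L))) ∂ρ :=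
          integral_mono (integrable_loss hφ hα₀ hα₁ hL hM hK hκ _)
            (i2.add (integrable_const _)) hle
      _ = _ := by
          rw [integral_add i2 (integrable_const _), integral_sub hif i1,
            integral_const_mul, integral_inner hvi, real_inner_comm]
          simp [genError, hG]
  have i1 : Integrable (fun z => c * ⟪G, v z⟫_ℝ) ρ := (hvi.const_inner _).const_mul _
  have i0 : Integrable (fun z : X × Y => 4 * L * (φ z.2 (f z.1) + L)) ρ :=
    (hif.add (integrable_const L)).const_mul _
  have i2 : Integrable (fun z : X × Y => B * (1 + 4 * L * (φ z.2 (f z.1) + L))) ρ :=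
    ((integrable_const _).add i0).const_mul _
  have i3 : Integrable (fun z => genError φ ρ f - c * ⟪G, v z⟫_ℝ) ρ :=
    (integrable_const _).sub i1
  calc _ ≤ ∫ z, (genError φ ρ f - c * ⟪G, v z⟫_ℝ
        + B * (1 + 4 * L * (φ z.2 (f z.1) + L))) ∂ρ :=
        integral_mono_of_nonneg (Eventually.of_forall fun z => genError_nonneg hφ ρ _)
          (i3.add i2) (Eventually.of_forall hpt)
    _ = genError φ ρ f - c * ⟪G, G⟫_ℝ + B * (1 + 4 * L * (genError φ ρ f + L)) := by
        rw [integral_add i3 i2, integral_sub (integrable_const _) i1, integral_const_mul,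
          integral_inner hvi, integral_const_mul, integral_add (integrable_const _) i0,
          integral_const_mul,
          integral_add hif (integrable_const _)]
        simp [genError, hG]
    _ ≤ _ := by
        have : 0 ≤ c * ⟪G, G⟫_ℝ := mul_nonneg hc real_inner_self_nonneg
        linarith

end GradientStep

/-! ### Averaging over an example independent of the past. -/

section FreshSample

variable {Ω Z : Type*} {mΩ : MeasurableSpace Ω} {mZ : MeasurableSpace Z} {P : Measure Ω}
  [IsProbabilityMeasure P] {ρ : Measure Z} {ζ : Ω → Z}

theorem ProbabilityTheory.IndepFun.setIntegral_comp_eq {Ω' : Type*} [MeasurableSpace Ω']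
    {U : Ω → Ω'} (hU : Measurable U) (hζ : Measurable ζ) (hlaw : P.map ζ = ρ)
    (hind : IndepFun U ζ P) {g : Ω' → Z → ℝ} (hg : Measurable (Function.uncurry g)) {C : ℝ}
    (hC : ∀ u z, |g u z| ≤ C) {A : Set Ω'} (hA : MeasurableSet A) :
    ∫ ω in U ⁻¹' A, g (U ω) (ζ ω) ∂P = ∫ ω in U ⁻¹' A, (∫ z, g (U ω) z ∂ρ) ∂P := by
  have : IsProbabilityMeasure ρ := hlaw ▸ Measure.isProbabilityMeasure_map hζ.aemeasurable
  have : IsProbabilityMeasure (P.map U) := Measure.isProbabilityMeasure_map hU.aemeasurable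
  have hjoint : P.map (fun ω => (U ω, ζ ω)) = (P.map U).prod ρ := by
    rw [hind.map_prod_eq_prod_map_map hU.aemeasurable hζ.aemeasurable, hlaw]
  have h1 : ∫ ω in U ⁻¹' A, g (U ω) (ζ ω) ∂P =
      ∫ p in A ×ˢ Set.univ, Function.uncurry g p ∂(P.map fun ω => (U ω, ζ ω)) := by
    rw [setIntegral_map (hA.prod MeasurableSet.univ) hg.aestronglyMeasurable
      (hU.prodMk hζ).aemeasurable]
    congr 2
    ext ω; simp
  have hint : Integrable (Function.uncurry g) ((P.map U).prod ρ) :=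
    Integrable.of_bound hg.aestronglyMeasurable C (Eventually.of_forall fun p => hC _ _)
  rw [h1, hjoint, setIntegral_prod _ hint.integrableOn, setIntegral_map hA _ hU.aemeasurable]
  · simp
  · simp only [Measure.restrict_univ]
    exact (hg.stronglyMeasurable.integral_prod_right).aestronglyMeasurable

/-- A conditional expectation bound given `m`, phrased through integrals over `m`-measurable sets.
-/
theorem setIntegral_fresh_le {Ω : Type*} {m mΩ : MeasurableSpace Ω} {P : Measure Ω}
    [IsProbabilityMeasure P] {ζ : Ω → Z} (hm : m ≤ mΩ) (hζ : Measurable ζ)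
    (hlaw : P.map ζ = ρ) (hind : Indep m (mZ.comap ζ) P) {g : Ω → Z → ℝ}
    (hg : Measurable[m.prod mZ] (Function.uncurry g)) {C : ℝ} (hC : ∀ ω z, |g ω z| ≤ C)
    {b : Ω → ℝ} (hb : Integrable b P) (hle : ∀ ω, ∫ z, g ω z ∂ρ ≤ b ω)
    {A : Set Ω} (hA : MeasurableSet[m] A) :
    ∫ ω in A, g ω (ζ ω) ∂P ≤ ∫ ω in A, b ω ∂P := by
  have hρ : IsProbabilityMeasure ρ := hlaw ▸ Measure.isProbabilityMeasure_map hζ.aemeasurable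
  -- The past is encoded as the identity into `Ω` carrying the smaller σ-algebra `m`, so the
  -- random-variable version applies.
  have hid : Measurable[mΩ, m] (id : Ω → Ω) := measurable_id'' hm
  have hind' : @IndepFun Ω Ω Z mΩ m mZ id ζ P := by
    refine (@IndepFun_iff_Indep Ω Ω Z mΩ m mZ id ζ P).2 ?_
    rwa [MeasurableSpace.comap_id]
  have key := @IndepFun.setIntegral_comp_eq Ω Z mΩ mZ P _ ρ ζ Ω m id hid hζ hlaw hind' g hg C hC
    A hA
  simp only [Set.preimage_id, id] at key
  rw [key]
  have hmeas : Measurable[m] fun ω => ∫ z, g ω z ∂ρ :=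
    (@StronglyMeasurable.integral_prod_right Ω Z ℝ m mZ ρ _ _ _ _
      hg.stronglyMeasurable).measurable
  refine setIntegral_mono (Integrable.integrableOn ?_) hb.integrableOn hle
  refine Integrable.of_bound (hmeas.mono hm le_rfl).aestronglyMeasurable C
    (Eventually.of_forall fun ω => ?_)
  refine (norm_integral_le_of_norm_le_const (Eventually.of_forall fun z => hC ω z)).trans ?_
  simp

end FreshSample

/-! ### The filtration of past examples. -/

section PastFiltration

variable {Ω Z : Type*} {mΩ : MeasurableSpace Ω} {mZ : MeasurableSpace Z} {P : Measure Ω}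
  {ρ : Measure Z} {z : ℕ → Ω → Z}

/-- The filtration whose `n`-th member is generated by the first `n` examples `z 1, …, z n`. -/
def IsIIDSample.past (hz : IsIIDSample z ρ P) : Filtration ℕ mΩ where
  seq n := ⨆ s ∈ Set.Iio n, mZ.comap (z (s + 1))
  mono' _ _ h := biSup_mono fun _ hs => lt_of_lt_of_le hs h
  le' _ := iSup₂_le fun s _ => (hz.measurable s).comap_le

theorem IsIIDSample.indep_past (hz : IsIIDSample z ρ P) (n : ℕ) :
    Indep (hz.past n) (mZ.comap (z (n + 1))) P := by
  have h := indep_iSup_of_disjoint (fun s => (hz.measurable s).comap_le) hz.indep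
    (S := Set.Iio n) (T := {n}) (by simp)
  simpa [past] using h

theorem IsIIDSample.measurable_past (hz : IsIIDSample z ρ P) (n : ℕ) :
    Measurable[hz.past (n + 1)] (z (n + 1)) := by
  rw [measurable_iff_comap_le]
  exact le_iSup₂_of_le (f := fun s (_ : s ∈ Set.Iio (n + 1)) => mZ.comap (z (s + 1))) n
    (Set.mem_Iio.2 n.lt_succ_self) le_rfl

end PastFiltration

/-! ### Almost sure boundedness from summable drift. -/

section AlmostSupermartingale

variable {Ω : Type*} {mΩ : MeasurableSpace Ω} {P : Measure Ω} [IsProbabilityMeasure P]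

theorem MeasureTheory.Submartingale.ae_bddAbove_abs {ℱ : Filtration ℕ mΩ} {f : ℕ → Ω → ℝ}
    (hf : Submartingale f ℱ P) {R : ℝ} (hR : ∀ n, ∫ ω, |f n ω| ∂P ≤ R) :
    ∀ᵐ ω ∂P, ∃ C, ∀ n, |f n ω| ≤ C := by
  have hbdd : ∀ n, eLpNorm (f n) 1 P ≤ (R.toNNReal : ENNReal) := fun n => by
    rw [eLpNorm_one_eq_lintegral_enorm, ← ofReal_integral_norm_eq_lintegral_enorm (hf.integrable n)]
    exact ENNReal.ofReal_le_ofReal (hR n)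
  filter_upwards [hf.exists_ae_tendsto_of_bdd hbdd] with ω ⟨c, hc⟩
  obtain ⟨C, hC⟩ := hc.abs.bddAbove_range
  exact ⟨C, fun n => hC ⟨n, rfl⟩⟩

/-- A nonnegative process whose conditional drift is at most `β n`, with `β` of summable mean, is
almost surely bounded. -/
theorem ae_bounded_of_setIntegral_succ_le {ℱ : Filtration ℕ mΩ} {W β : ℕ → Ω → ℝ}
    (hW : StronglyAdapted ℱ W) (hWint : ∀ n, Integrable (W n) P) (hW₀ : ∀ n ω, 0 ≤ W n ω)
    (hβ : StronglyAdapted ℱ β) (hβint : ∀ n, Integrable (β n) P) (hβ₀ : ∀ n ω, 0 ≤ β n ω)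
    (hsum : Summable fun n => ∫ ω, β n ω ∂P)
    (hdrift : ∀ n A, MeasurableSet[ℱ n] A →
      ∫ ω in A, W (n + 1) ω ∂P ≤ ∫ ω in A, (W n ω + β n ω) ∂P) :
    ∀ᵐ ω ∂P, ∃ C, ∀ n, W n ω ≤ C := by
  set S : ℕ → Ω → ℝ := fun n ω => ∑ i ∈ Finset.range n, β i ω with hS
  have hSint : ∀ n, Integrable (S n) P := fun n => integrable_finsetSum _ fun i _ => hβint i
  have hS₀ : ∀ n ω, 0 ≤ S n ω := fun n ω => Finset.sum_nonneg fun i _ => hβ₀ i ω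
  have hSad : StronglyAdapted ℱ S := fun n =>
    Finset.stronglyMeasurable_fun_sum _ fun i hi =>
      (hβ i).mono (ℱ.mono (Finset.mem_range.1 hi).le)
  have hSsucc : ∀ n ω, S (n + 1) ω = S n ω + β n ω := fun n ω => Finset.sum_range_succ _ _
  set B := ∑' n, ∫ ω, β n ω ∂P with hB
  have hSB : ∀ n, ∫ ω, S n ω ∂P ≤ B := fun n => by
    rw [integral_finsetSum _ fun i _ => hβint i]
    exact hsum.sum_le_tsum _ fun i _ => integral_nonneg (hβ₀ i)
  have hWB : ∀ n, ∫ ω, W n ω ∂P ≤ ∫ ω, W 0 ω ∂P + ∫ ω, S n ω ∂P := by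
    intro n
    induction n with
    | zero => simp [hS]
    | succ n ih =>
      have h := hdrift n Set.univ MeasurableSet.univ
      simp only [Measure.restrict_univ] at h
      rw [integral_add (hWint n) (hβint n)] at h
      simp only [hSsucc]
      rw [integral_add (hSint n) (hβint n)]
      linarith
  have hsub₁ : Submartingale S ℱ P := by
    refine submartingale_of_setIntegral_le_succ hSad hSint fun n A _ => ?_
    refine setIntegral_mono (hSint n).integrableOn (hSint _).integrableOn fun ω => ?_
    rw [hSsucc]
    linarith [hβ₀ n ω]
  -- The drift bound says exactly this. Both `S` and `S - W` are `L¹`-bounded submartingales, hence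
  -- almost surely bounded, and `W` is their difference.
  have hsub₂ : Submartingale (fun n ω => S n ω - W n ω) ℱ P := by
    refine submartingale_of_setIntegral_le_succ (fun n => (hSad n).sub (hW n))
      (fun n => (hSint n).sub (hWint n)) fun n A hA => ?_
    have h := hdrift n A hA
    rw [integral_add (hWint n).integrableOn (hβint n).integrableOn] at h
    simp only [hSsucc]
    have hi : Integrable (fun ω => S n ω + β n ω) P := (hSint n).add (hβint n)
    rw [integral_sub (hSint n).integrableOn (hWint n).integrableOn,
      integral_sub hi.integrableOn (hWint _).integrableOn,
      integral_add (hSint n).integrableOn (hβint n).integrableOn]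
    linarith
  have hb₁ : ∀ n, ∫ ω, |S n ω| ∂P ≤ B := fun n => by
    simpa only [abs_of_nonneg (hS₀ n _)] using hSB n
  have hb₂ : ∀ n, ∫ ω, |S n ω - W n ω| ∂P ≤ ∫ ω, W 0 ω ∂P + B + B := fun n => by
    calc _ ≤ ∫ ω, (S n ω + W n ω) ∂P := by
          refine integral_mono ((hSint n).sub (hWint n)).abs ((hSint n).add (hWint n)) fun ω => ?_
          exact abs_sub_le_iff.2 ⟨by linarith [hW₀ n ω], by linarith [hS₀ n ω]⟩
      _ ≤ _ := by
          rw [integral_add (hSint n) (hWint n)]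
          linarith [hSB n, hWB n]
  filter_upwards [hsub₁.ae_bddAbove_abs hb₁, hsub₂.ae_bddAbove_abs hb₂] with ω ⟨C₁, h₁⟩ ⟨C₂, h₂⟩
  refine ⟨C₁ + C₂, fun n => ?_⟩
  have a1 := le_abs_self (S n ω)
  have a2 := neg_abs_le (S n ω - W n ω)
  linarith [h₁ n, h₂ n]

end AlmostSupermartingale

/-! ### Deterministic sequences and power weights. -/

section RealSequences

theorem summable_mul_of_succ_le {a d η : ℕ → ℝ} {c e : ℝ} (ha : ∀ n, 0 ≤ a n) (hd : ∀ n, 0 ≤ d n)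
    (hη : ∀ n, 0 ≤ η n) (hc : 0 ≤ c) (he : 0 ≤ e) (hη2 : Summable fun n => η n ^ 2)
    (h : ∀ n, a (n + 1) ≤ a n - 2 * η n * d n + c * η n ^ 2 * (d n + e)) :
    Summable fun n => η n * d n := by
  have h0 : Tendsto (fun n => c ^ 2 * η n ^ 2) atTop (𝓝 0) := by
    simpa using hη2.tendsto_atTop_zero.const_mul (c ^ 2)
  obtain ⟨N, hN⟩ := eventually_atTop.1 (h0.eventually (gt_mem_nhds one_pos))
  -- Once `c * η n ≤ 1`, the quadratic term in `d n` absorbs only half of the decrease `2 * η n * d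
  -- n`; the rest telescopes.
  have hstep : ∀ n ≥ N, η n * d n ≤ a n - a (n + 1) + c * e * η n ^ 2 := by
    intro n hn
    have h1 : c * η n ≤ 1 := by
      refine abs_le_of_sq_le_sq' ?_ zero_le_one |>.2
      rw [mul_pow]
      linarith [hN n hn]
    have h2 := mul_le_mul_of_nonneg_right h1 (mul_nonneg (hη n) (hd n))
    linarith [h n]
  rw [← summable_nat_add_iff N]
  refine summable_of_sum_range_le (c := a N + c * e * ∑' n, η (n + N) ^ 2)
    (fun n => mul_nonneg (hη _) (hd _)) fun m => ?_
  have hs : ∑ i ∈ Finset.range m, η (i + N) ^ 2 ≤ ∑' n, η (n + N) ^ 2 :=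
    ((summable_nat_add_iff N).2 hη2).sum_le_tsum _ fun _ _ => sq_nonneg _
  have hm : ∑ i ∈ Finset.range m, η (i + N) * d (i + N) ≤
      a N - a (m + N) + c * e * ∑ i ∈ Finset.range m, η (i + N) ^ 2 := by
    induction m with
    | zero => simp
    | succ m ih =>
      rw [Finset.sum_range_succ, Finset.sum_range_succ]
      have h1 := hstep (m + N) (by omega)
      rw [show m + 1 + N = m + N + 1 by omega]
      have h2 := ih (((summable_nat_add_iff N).2 hη2).sum_le_tsum _ fun _ _ => sq_nonneg _)
      linarith
  have := mul_le_mul_of_nonneg_left hs (mul_nonneg hc he)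
  linarith [ha (m + N)]

theorem add_one_rpow_le {x p : ℝ} (hx : 1 ≤ x) (hp₀ : 0 ≤ p) (hp₁ : p ≤ 1) :
    (x + 1) ^ p ≤ x ^ p + x ^ (p - 1) := by
  have hx₀ : 0 < x := by linarith
  have h1 : (1 + 1 / x) ^ p ≤ 1 + p * (1 / x) :=
    rpow_one_add_le_one_add_mul_self (by have : 0 ≤ 1 / x := by positivity
                                         linarith) hp₀ hp₁
  have h2 : 1 + p * (1 / x) ≤ 1 + 1 / x := by
    have : 0 ≤ 1 / x := by positivity
    nlinarith
  calc (x + 1) ^ p = x ^ p * (1 + 1 / x) ^ p := by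
        rw [← Real.mul_rpow hx₀.le (by positivity)]
        congr 1
        field_simp
    _ ≤ x ^ p * (1 + 1 / x) := by gcongr; exact h1.trans h2
    _ = x ^ p + x ^ (p - 1) := by rw [Real.rpow_sub_one hx₀.ne']; ring

theorem summable_natCast_add_one_rpow {q : ℝ} (hq : q < -1) :
    Summable fun n : ℕ => ((n : ℝ) + 1) ^ q := by
  have := (summable_nat_add_iff 1).2 (Real.summable_nat_rpow.2 hq)
  simpa using this

end RealSequences

/-! ### The random iterates and their convergence rate. -/

section OnlineGradientDescent

variable {X Y : Type*} {H : Type*} [NormedAddCommGroup H] [InnerProductSpace ℝ H]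
  [CompleteSpace H] [RKHS ℝ H X ℝ] {φ : Y → ℝ → ℝ} {α L κ : ℝ}

theorem onlineGD_add_two (φ : Y → ℝ → ℝ) (η : ℕ → ℝ) (z : ℕ → X × Y) (n : ℕ) :
    onlineGD H φ η z (n + 2) = gdStep φ (η (n + 1)) (onlineGD H φ η z (n + 1)) (z (n + 1)) :=
  rfl

variable [MeasurableSpace Y]

/-- The bound may grow with `n`: it serves only for integrability. -/
theorem exists_norm_onlineGD_le (hφ : IsHolderLoss φ α L) (hα₀ : 0 < α) (hα₁ : α ≤ 1)
    (hL : 0 < L) (hM : BddAbove (Set.range fun y => φ y 0))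
    (hκ : ∀ x : X, ‖RKHS.kerFun H x (1 : ℝ)‖ ≤ κ) (hκ₀ : 0 ≤ κ) (η : ℕ → ℝ) (n : ℕ) :
    ∃ R, ∀ z : ℕ → X × Y, ‖onlineGD H φ η z (n + 1)‖ ≤ R := by
  induction n with
  | zero => exact ⟨0, fun z => by simp [onlineGD]⟩
  | succ n ih =>
    obtain ⟨R, hR⟩ := ih
    obtain ⟨C, -, hC⟩ := hφ.exists_bound hα₀ hα₁ hL hM (R * κ)
    refine ⟨_, fun z => norm_gdStep_le hκ _ _ (hR z) (hC _ _ ?_).2⟩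
    exact (RKHS.abs_apply_le hκ _ _).trans (by gcongr; exact hR z)

variable [MeasurableSpace X] {ρ : Measure (X × Y)} {Ω : Type*} {mΩ : MeasurableSpace Ω}
  {P : Measure Ω} {z : ℕ → Ω → X × Y}

/-- Transfers a one-step average, valid at every fixed `f`, to the iterates. It is used with `Ψ` the
squared distance to `h` and with `Ψ` the weighted excess error. -/
theorem setIntegral_onlineGD_succ_le [IsProbabilityMeasure P] (hφ : IsHolderLoss φ α L)
    (hα₀ : 0 < α) (hα₁ : α ≤ 1)
    (hL : 0 < L) (hM : BddAbove (Set.range fun y => φ y 0))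
    (hκ : ∀ x : X, ‖RKHS.kerFun H x (1 : ℝ)‖ ≤ κ) (hκ₀ : 0 ≤ κ) (hz : IsIIDSample z ρ P)
    (η : ℕ → ℝ) (n : ℕ) {Ψ b : H → ℝ}
    (hΨm : Measurable[(hz.past n).prod inferInstance] fun p : Ω × (X × Y) =>
      Ψ (gdStep φ (η (n + 1)) (onlineGD H φ η (fun s => z s p.1) (n + 1)) p.2))
    (hΨb : ∀ R, ∃ C, ∀ f, ‖f‖ ≤ R → |Ψ f| ≤ C)
    (hb : Integrable (fun ω => b (onlineGD H φ η (fun s => z s ω) (n + 1))) P)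
    (hle : ∀ f, ∫ x, Ψ (gdStep φ (η (n + 1)) f x) ∂ρ ≤ b f)
    {A : Set Ω} (hA : MeasurableSet[hz.past n] A) :
    ∫ ω in A, Ψ (onlineGD H φ η (fun s => z s ω) (n + 2)) ∂P ≤
      ∫ ω in A, b (onlineGD H φ η (fun s => z s ω) (n + 1)) ∂P := by
  obtain ⟨R, hR⟩ := exists_norm_onlineGD_le hφ hα₀ hα₁ hL hM hκ hκ₀ η n
  obtain ⟨C, -, hC⟩ := hφ.exists_bound hα₀ hα₁ hL hM (R * κ)
  obtain ⟨C', hC'⟩ := hΨb (R + |η (n + 1)| * C * κ)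
  refine setIntegral_fresh_le (hz.past.le n) (hz.measurable n) (hz.law n) (hz.indep_past n)
    (g := fun ω x => Ψ (gdStep φ (η (n + 1)) (onlineGD H φ η (fun s => z s ω) (n + 1)) x))
    hΨm (C := C') (fun ω x => hC' _ (norm_gdStep_le hκ _ _ (hR _) (hC _ _ ?_).2)) hb
    (fun ω => hle _) hA
  exact (RKHS.abs_apply_le hκ _ _).trans (by gcongr; exact hR _)

variable [TopologicalSpace X] [SecondCountableTopology X] [OpensMeasurableSpace X]

/-- Iterate `n + 1` uses only the examples `1, …, n`, which generate `hz.past n`; example `n + 1` is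
therefore fresh. -/
theorem stronglyMeasurable_onlineGD (hφ : IsHolderLoss φ α L)
    (hK : Continuous fun x : X => RKHS.kerFun H x (1 : ℝ)) (hz : IsIIDSample z ρ P) (η : ℕ → ℝ)
    (n : ℕ) :
    StronglyMeasurable[hz.past n] fun ω => onlineGD H φ η (fun s => z s ω) (n + 1) := by
  induction n with
  | zero => exact stronglyMeasurable_const
  | succ n ih =>
    simp only [onlineGD_add_two]
    exact @stronglyMeasurable_gdStep X Y H _ _ _ _ φ α L _ _ _ _ _ Ω (hz.past (n + 1)) hφ hK _ _ _
      (ih.mono (hz.past.mono n.le_succ)) (hz.measurable_past n)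

theorem stronglyMeasurable_gdStep_past (hφ : IsHolderLoss φ α L)
    (hK : Continuous fun x : X => RKHS.kerFun H x (1 : ℝ)) (hz : IsIIDSample z ρ P) (η : ℕ → ℝ)
    (n : ℕ) :
    StronglyMeasurable[(hz.past n).prod inferInstance] fun p : Ω × (X × Y) =>
      gdStep φ (η (n + 1)) (onlineGD H φ η (fun s => z s p.1) (n + 1)) p.2 := by
  have h := stronglyMeasurable_onlineGD hφ hK hz η n
  let := hz.past n
  exact stronglyMeasurable_gdStep hφ hK _ (h.comp_measurable measurable_fst) measurable_snd

variable [IsProbabilityMeasure P] [IsProbabilityMeasure ρ]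

theorem integrable_genError_onlineGD (hφ : IsHolderLoss φ α L) (hα₀ : 0 < α) (hα₁ : α ≤ 1)
    (hL : 0 < L) (hM : BddAbove (Set.range fun y => φ y 0))
    (hK : Continuous fun x : X => RKHS.kerFun H x (1 : ℝ))
    (hκ : ∀ x : X, ‖RKHS.kerFun H x (1 : ℝ)‖ ≤ κ) (hκ₀ : 0 ≤ κ) (hz : IsIIDSample z ρ P)
    (η : ℕ → ℝ) (n : ℕ) :
    Integrable (fun ω => genError φ ρ (onlineGD H φ η (fun s => z s ω) (n + 1))) P := by
  obtain ⟨R, hR⟩ := exists_norm_onlineGD_le (H := H) hφ hα₀ hα₁ hL hM hκ hκ₀ η n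
  obtain ⟨C, hC⟩ := exists_genError_le (H := H) (ρ := ρ) hφ hα₀ hα₁ hL hM hK hκ hκ₀ R
  refine Integrable.of_bound (C := C) (stronglyMeasurable_genError hφ hK ρ
    ((stronglyMeasurable_onlineGD hφ hK hz η n).mono (hz.past.le n))).aestronglyMeasurable
    (Eventually.of_forall fun ω => ?_)
  rw [Real.norm_eq_abs, abs_of_nonneg (genError_nonneg hφ ρ _)]
  exact hC _ (hR _)

theorem summable_integral_excess (hφ : IsHolderLoss φ α L) (hα₀ : 0 < α) (hα₁ : α ≤ 1)
    (hL : 0 < L) (hM : BddAbove (Set.range fun y => φ y 0))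
    (hK : Continuous fun x : X => RKHS.kerFun H x (1 : ℝ))
    (hκ : ∀ x : X, ‖RKHS.kerFun H x (1 : ℝ)‖ ≤ κ) (hκ₀ : 0 ≤ κ) (hz : IsIIDSample z ρ P)
    {η : ℕ → ℝ} (hη : ∀ n, 0 ≤ η (n + 1)) (hη2 : Summable fun n => η (n + 1) ^ 2)
    {h : H} (hh : ∀ f : H, genError φ ρ h ≤ genError φ ρ f) :
    Summable fun n => η (n + 1) * ∫ ω, (genError φ ρ (onlineGD H φ η (fun s => z s ω) (n + 1))
      - genError φ ρ h) ∂P := by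
  have hEint := integrable_genError_onlineGD (H := H) hφ hα₀ hα₁ hL hM hK hκ hκ₀ hz η
  have hNint : ∀ n, Integrable
      (fun ω => ‖onlineGD H φ η (fun s => z s ω) (n + 1) - h‖ ^ 2) P := fun n => by
    obtain ⟨R, hR⟩ := exists_norm_onlineGD_le (H := H) hφ hα₀ hα₁ hL hM hκ hκ₀ η n
    have hm := ((stronglyMeasurable_onlineGD (H := H) hφ hK hz η n).mono (hz.past.le n))
    refine Integrable.of_bound (C := (R + ‖h‖) ^ 2)
      ((hm.sub stronglyMeasurable_const).norm.pow 2).aestronglyMeasurable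
      (Eventually.of_forall fun ω => ?_)
    rw [Real.norm_eq_abs, abs_of_nonneg (sq_nonneg _)]
    gcongr
    exact (norm_sub_le _ _).trans (by gcongr; exact hR _)
  -- This `e` rewrites `genError φ ρ f + L` as excess error plus `e`.
  refine summable_mul_of_succ_le (c := κ ^ 2 * (4 * L)) (e := genError φ ρ h + L)
    (a := fun n => ∫ ω, ‖onlineGD H φ η (fun s => z s ω) (n + 1) - h‖ ^ 2 ∂P)
    (fun n => integral_nonneg fun ω => sq_nonneg _)
    (fun n => integral_nonneg fun ω => sub_nonneg.2 (hh _)) hη (by positivity)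
    (add_nonneg (genError_nonneg hφ ρ _) hL.le) hη2 fun n => ?_
  have i1 : Integrable (fun ω => genError φ ρ (onlineGD H φ η (fun s => z s ω) (n + 1))
      - genError φ ρ h) P := (hEint n).sub (integrable_const _)
  have i2 : Integrable (fun ω => 2 * η (n + 1) *
      (genError φ ρ (onlineGD H φ η (fun s => z s ω) (n + 1)) - genError φ ρ h)) P :=
    i1.const_mul _
  have i3 : Integrable (fun ω => κ ^ 2 * (4 * L) * η (n + 1) ^ 2 *
      (genError φ ρ (onlineGD H φ η (fun s => z s ω) (n + 1)) - genError φ ρ h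
        + (genError φ ρ h + L))) P := (i1.add (integrable_const _)).const_mul _
  have i4 : Integrable (fun ω => ‖onlineGD H φ η (fun s => z s ω) (n + 1) - h‖ ^ 2 -
      2 * η (n + 1) * (genError φ ρ (onlineGD H φ η (fun s => z s ω) (n + 1))
        - genError φ ρ h)) P := (hNint n).sub i2
  have key := setIntegral_onlineGD_succ_le hφ hα₀ hα₁ hL hM hκ hκ₀ hz η n
    (Ψ := fun f => ‖f - h‖ ^ 2)
    (b := fun f => ‖f - h‖ ^ 2 - 2 * η (n + 1) * (genError φ ρ f - genError φ ρ h)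
      + κ ^ 2 * (4 * L) * η (n + 1) ^ 2 *
        (genError φ ρ f - genError φ ρ h + (genError φ ρ h + L)))
    (((stronglyMeasurable_gdStep_past hφ hK hz η n).sub stronglyMeasurable_const).norm.pow
      2).measurable
    (fun R => ⟨(R + ‖h‖) ^ 2, fun f hf => by
      rw [abs_of_nonneg (sq_nonneg _)]
      gcongr
      exact (norm_sub_le _ _).trans (by gcongr)⟩)
    (i4.add i3)
    (fun f => (integral_norm_gdStep_sub_sq_le hφ hα₀ hα₁ hL hM hK hκ (hη n) f h).trans
      (le_of_eq (by ring)))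
    MeasurableSet.univ
  simp only [Measure.restrict_univ] at key
  rw [integral_add i4 i3, integral_sub (hNint n) i2, integral_const_mul, integral_const_mul,
    integral_add i1 (integrable_const _)] at key
  simpa using key

theorem ae_bounded_rpow_mul_excess (hφ : IsHolderLoss φ α L) (hα₀ : 0 < α) (hα₁ : α ≤ 1)
    (hL : 0 < L) (hM : BddAbove (Set.range fun y => φ y 0))
    (hK : Continuous fun x : X => RKHS.kerFun H x (1 : ℝ))
    (hκ : ∀ x : X, ‖RKHS.kerFun H x (1 : ℝ)‖ ≤ κ) (hκ₀ : 0 ≤ κ) (hz : IsIIDSample z ρ P)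
    {h : H} (hh : ∀ f : H, genError φ ρ h ≤ genError φ ρ f) {η₁ θ p : ℝ} (hη₁ : 0 < η₁)
    (hθ₀ : 1 / 2 < θ) (hθ₁ : θ < 1) (hp₀ : 0 ≤ p) (hp₁ : p ≤ 1 - θ)
    (hp₂ : p < (α + 1) * θ - 1) :
    ∀ᵐ ω ∂P, ∃ C, ∀ n : ℕ, ((n : ℝ) + 1) ^ p *
      (genError φ ρ (onlineGD H φ (polyStep η₁ θ) (fun s => z s ω) (n + 1))
        - genError φ ρ h) ≤ C := by
  set η := polyStep η₁ θ with hη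
  have hηs : ∀ n : ℕ, η (n + 1) = η₁ * ((n : ℝ) + 1) ^ (-θ) := fun n => by simp [hη, polyStep]
  have hη₀ : ∀ n : ℕ, 0 ≤ η (n + 1) := fun n => by rw [hηs]; positivity
  have hη2 : Summable fun n : ℕ => η (n + 1) ^ 2 := by
    have : ∀ n : ℕ, η (n + 1) ^ 2 = η₁ ^ 2 * ((n : ℝ) + 1) ^ (-(2 * θ)) := fun n => by
      rw [hηs, mul_pow, ← Real.rpow_mul_natCast (by positivity)]
      congr 2; push_cast; ring
    simp only [this]
    exact (summable_natCast_add_one_rpow (by linarith)).mul_left _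
  set D : ℕ → Ω → ℝ := fun n ω =>
    genError φ ρ (onlineGD H φ η (fun s => z s ω) (n + 1)) - genError φ ρ h with hD
  have hD₀ : ∀ n ω, 0 ≤ D n ω := fun n ω => sub_nonneg.2 (hh _)
  have hDint : ∀ n, Integrable (D n) P := fun n =>
    (integrable_genError_onlineGD hφ hα₀ hα₁ hL hM hK hκ hκ₀ hz η n).sub (integrable_const _)
  have hDad : StronglyAdapted hz.past D := fun n =>
    (@stronglyMeasurable_genError X Y H _ _ _ _ φ α L _ _ _ _ _ Ω (hz.past n) hφ hK ρ _ _
      (stronglyMeasurable_onlineGD hφ hK hz η n)).sub stronglyMeasurable_const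
  have hEh := genError_nonneg hφ ρ h
  -- Chosen so that `1 + 4 * L * (genError φ ρ f + L)` equals `4 * L` times excess error plus `e`.
  set e := genError φ ρ h + L + 1 / (4 * L) with he
  have he₀ : 0 ≤ e := by positivity
  set c := 4 * L * L * (η₁ * κ ^ 2) ^ (1 + α) with hc
  have hc₀ : 0 ≤ c := by positivity
  have hd : Summable fun n : ℕ => ((n : ℝ) + 1) ^ (-θ) * ∫ ω, D n ω ∂P := by
    have := (summable_integral_excess hφ hα₀ hα₁ hL hM hK hκ hκ₀ hz hη₀ hη2 hh).mul_left η₁⁻¹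
    refine this.congr fun n => ?_
    rw [hηs]
    field_simp
    rfl
  have hd₀ : ∀ n, 0 ≤ ∫ ω, D n ω ∂P := fun n => integral_nonneg (hD₀ n)
  have hbase : ∀ n : ℕ, (1 : ℝ) ≤ (n : ℝ) + 1 := fun n => by
    have : (0 : ℝ) ≤ n := Nat.cast_nonneg n
    linarith
  set q := p - (α + 1) * θ with hq
  have hβ_int : ∀ n : ℕ, ∫ ω, (((n : ℝ) + 1) ^ (p - 1) * D n ω
      + 2 * c * ((n : ℝ) + 1) ^ q * (D n ω + e)) ∂P =
      ((n : ℝ) + 1) ^ (p - 1) * ∫ ω, D n ω ∂P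
        + 2 * c * (((n : ℝ) + 1) ^ q * ∫ ω, D n ω ∂P) + 2 * c * e * ((n : ℝ) + 1) ^ q := by
    intro n
    have i0 : Integrable (fun ω => D n ω + e) P := (hDint n).add (integrable_const _)
    rw [integral_add ((hDint n).const_mul _) (i0.const_mul _), integral_const_mul,
      integral_const_mul, integral_add (hDint n) (integrable_const _)]
    simp only [integral_const, probReal_univ, one_smul]
    ring
  have hcmp : ∀ r ≤ -θ, Summable fun n : ℕ => ((n : ℝ) + 1) ^ r * ∫ ω, D n ω ∂P := fun r hr =>
    Summable.of_nonneg_of_le (fun n => mul_nonneg (by positivity) (hd₀ n))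
      (fun n => mul_le_mul_of_nonneg_right
        (Real.rpow_le_rpow_of_exponent_le (hbase n) hr) (hd₀ n)) hd
  have hgoal := ae_bounded_of_setIntegral_succ_le (P := P) (ℱ := hz.past)
    (W := fun n ω => ((n : ℝ) + 1) ^ p * D n ω)
    (β := fun n ω => ((n : ℝ) + 1) ^ (p - 1) * D n ω
      + 2 * c * ((n : ℝ) + 1) ^ q * (D n ω + e))
    (fun n => (hDad n).const_mul _) (fun n => (hDint n).const_mul _)
    (fun n ω => mul_nonneg (by positivity) (hD₀ n ω))
    (fun n => ((hDad n).const_mul _).add (((hDad n).add stronglyMeasurable_const).const_mul _))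
    (fun n => ((hDint n).const_mul _).add (((hDint n).add (integrable_const _)).const_mul _))
    (fun n ω => by have := hD₀ n ω; positivity)
    -- Three series: `p - 1 ≤ -θ` and `q ≤ -θ` compare with `hd`, and `q < -1` handles the
    -- deterministic one.
    (by
      simp only [hβ_int]
      exact ((hcmp _ (by linarith)).add ((hcmp _ (by rw [hq]; linarith)).mul_left _)).add
        ((summable_natCast_add_one_rpow (by rw [hq]; linarith)).mul_left _))
    ?_
  · exact hgoal
  · intro n A hA
    set x : ℝ := (n : ℝ) + 1 with hx
    have hx₁ : 1 ≤ x := hbase n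
    have hx₀ : 0 < x := by linarith
    refine setIntegral_onlineGD_succ_le hφ hα₀ hα₁ hL hM hκ hκ₀ hz η n
      (Ψ := fun f => (((n + 1 : ℕ) : ℝ) + 1) ^ p * (genError φ ρ f - genError φ ρ h))
      (b := fun f => x ^ p * (genError φ ρ f - genError φ ρ h) +
        (x ^ (p - 1) * (genError φ ρ f - genError φ ρ h)
          + 2 * c * x ^ q * (genError φ ρ f - genError φ ρ h + e)))
      ?_ ?_ ?_ ?_ hA
    · have hm := stronglyMeasurable_gdStep_past hφ hK hz η n
      let := hz.past n
      exact (((stronglyMeasurable_genError hφ hK ρ hm).sub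
        stronglyMeasurable_const).const_mul _).measurable
    · intro R
      obtain ⟨C, hC⟩ := exists_genError_le (H := H) (ρ := ρ) hφ hα₀ hα₁ hL hM hK hκ hκ₀ R
      refine ⟨(((n + 1 : ℕ) : ℝ) + 1) ^ p * C, fun f hf => ?_⟩
      rw [abs_mul, abs_of_nonneg (by positivity), abs_of_nonneg (sub_nonneg.2 (hh f))]
      gcongr
      linarith [hC f hf]
    · exact ((hDint n).const_mul _).add
        (((hDint n).const_mul _).add (((hDint n).add (integrable_const _)).const_mul _))
    · intro f
      have h1 := integral_genError_gdStep_le (ρ := ρ) hφ hα₀ hα₁ hL hM hK hκ hκ₀ (hη₀ n) f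
      have hsum : (((n + 1 : ℕ) : ℝ) + 1) ^ p ≤ x ^ p + x ^ (p - 1) := by
        have := add_one_rpow_le hx₁ hp₀ (by linarith : p ≤ 1)
        simpa [hx] using this
      -- The sharp increment `hsum` is needed for the main term; for the smoothness error a factor
      -- `2` suffices.
      have hdouble : (((n + 1 : ℕ) : ℝ) + 1) ^ p ≤ 2 * x ^ p := by
        have := Real.rpow_le_rpow_of_exponent_le hx₁ (by linarith : p - 1 ≤ p)
        linarith
      set Δ := genError φ ρ f - genError φ ρ h with hΔ
      have hΔ₀ : 0 ≤ Δ := sub_nonneg.2 (hh f)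
      have hi : Integrable (fun y => genError φ ρ (gdStep φ (η (n + 1)) f y : H)) ρ := by
        obtain ⟨C, -, hC⟩ := hφ.exists_bound hα₀ hα₁ hL hM (‖f‖ * κ)
        obtain ⟨C', hC'⟩ := exists_genError_le (H := H) (ρ := ρ) hφ hα₀ hα₁ hL hM hK hκ hκ₀
          (‖f‖ + |η (n + 1)| * C * κ)
        refine Integrable.of_bound (C := C') (stronglyMeasurable_genError hφ hK ρ
          (stronglyMeasurable_gdStep hφ hK _ stronglyMeasurable_const
            measurable_id)).aestronglyMeasurable (Eventually.of_forall fun y => ?_)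
        rw [Real.norm_eq_abs, abs_of_nonneg (genError_nonneg hφ ρ _)]
        exact hC' _ (norm_gdStep_le hκ _ _ le_rfl (hC _ _ (RKHS.abs_apply_le hκ _ _)).2)
      have h2 : L * (η (n + 1) * κ ^ 2) ^ (1 + α) * (1 + 4 * L * (genError φ ρ f + L)) =
          c * x ^ (-((α + 1) * θ)) * (Δ + e) := by
        rw [hηs, mul_right_comm η₁, Real.mul_rpow (by positivity) (by positivity),
          ← Real.rpow_mul (by positivity), show -θ * (1 + α) = -((α + 1) * θ) by ring, hc, hΔ, he]
        field_simp
        ring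
      rw [h2] at h1
      have h3 : x ^ p * x ^ (-((α + 1) * θ)) = x ^ q := by
        rw [← Real.rpow_add hx₀, hq, sub_eq_add_neg]
      rw [integral_const_mul, integral_sub hi (integrable_const _)]
      simp only [integral_const, probReal_univ, one_smul]
      have hT : 0 ≤ c * x ^ (-((α + 1) * θ)) * (Δ + e) := by positivity
      calc _ ≤ (((n + 1 : ℕ) : ℝ) + 1) ^ p * (Δ + c * x ^ (-((α + 1) * θ)) * (Δ + e)) := by
            gcongr
            linarith
        _ = (((n + 1 : ℕ) : ℝ) + 1) ^ p * Δ
            + (((n + 1 : ℕ) : ℝ) + 1) ^ p * (c * x ^ (-((α + 1) * θ)) * (Δ + e)) := by ring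
        _ ≤ (x ^ p + x ^ (p - 1)) * Δ
            + 2 * x ^ p * (c * x ^ (-((α + 1) * θ)) * (Δ + e)) := by gcongr
        _ = _ := by rw [← h3]; ring

theorem ae_tendsto_rpow_mul_excess (hφ : IsHolderLoss φ α L) (hα₀ : 0 < α) (hα₁ : α ≤ 1)
    (hL : 0 < L) (hM : BddAbove (Set.range fun y => φ y 0))
    (hK : Continuous fun x : X => RKHS.kerFun H x (1 : ℝ))
    (hκ : ∀ x : X, ‖RKHS.kerFun H x (1 : ℝ)‖ ≤ κ) (hκ₀ : 0 ≤ κ) (hz : IsIIDSample z ρ P)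
    {h : H} (hh : ∀ f : H, genError φ ρ h ≤ genError φ ρ f) {η₁ θ ε : ℝ} (hη₁ : 0 < η₁)
    (hθ : θ ∈ Set.Ioo (1 / (α + 1)) 1) (hε : 0 < ε) :
    ∀ᵐ ω ∂P, Tendsto (fun t : ℕ => (t : ℝ) ^ (min (1 - θ) ((α + 1) * θ - 1) - ε) *
      (genError φ ρ (onlineGD H φ (polyStep η₁ θ) (fun s => z s ω) t) - genError φ ρ h))
      atTop (𝓝 0) := by
  obtain ⟨hθ₀, hθ₁⟩ := hθ
  have hθα : 1 < (α + 1) * θ := by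
    rw [div_lt_iff₀ (by positivity)] at hθ₀
    linarith
  set r := min (1 - θ) ((α + 1) * θ - 1) with hr
  have hr₀ : 0 < r := lt_min (by linarith) (by linarith)
  -- Half of `ε` keeps `p` strictly subcritical, the other half gives the decaying factor `t ^ (-(ε
  -- / 2))`. The maximum with `0` covers large `ε`, as the weight must be nondecreasing.
  set p := max (r - ε / 2) 0 with hp
  have hpr : p < r := max_lt (by linarith) hr₀
  have hb := ae_bounded_rpow_mul_excess hφ hα₀ hα₁ hL hM hK hκ hκ₀ hz hh hη₁ (θ := θ) (p := p)
    (by nlinarith) hθ₁ (le_max_right _ _) (hpr.le.trans (min_le_left _ _))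
    (hpr.trans_le (min_le_right _ _))
  filter_upwards [hb] with ω ⟨C, hC⟩
  have hlim : Tendsto (fun n : ℕ => ((n : ℝ)) ^ (-(ε / 2)) * C) atTop (𝓝 0) := by
    simpa using ((tendsto_rpow_neg_atTop (by positivity : 0 < ε / 2)).comp
      tendsto_natCast_atTop_atTop).mul_const C
  refine squeeze_zero' (Eventually.of_forall fun n =>
    mul_nonneg (by positivity) (sub_nonneg.2 (hh _))) ?_ hlim
  filter_upwards [eventually_ge_atTop 1] with t ht
  obtain ⟨n, rfl⟩ : ∃ n, t = n + 1 := ⟨t - 1, by omega⟩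
  have h1 := hC n
  have hx₁ : (1 : ℝ) ≤ ((n + 1 : ℕ) : ℝ) := by exact_mod_cast ht
  rw [← Nat.cast_add_one] at h1
  set D := genError φ ρ (onlineGD H φ (polyStep η₁ θ) (fun s => z s ω) (n + 1)) - genError φ ρ h
  have hD₀ : 0 ≤ D := sub_nonneg.2 (hh _)
  calc ((n + 1 : ℕ) : ℝ) ^ (r - ε) * D
      ≤ ((n + 1 : ℕ) : ℝ) ^ (-(ε / 2) + p) * D := by
        gcongr ?_ * D
        refine Real.rpow_le_rpow_of_exponent_le hx₁ ?_
        linarith [le_max_left (r - ε / 2) 0]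
    _ = ((n + 1 : ℕ) : ℝ) ^ (-(ε / 2)) * (((n + 1 : ℕ) : ℝ) ^ p * D) := by
        rw [Real.rpow_add (by linarith)]; ring
    _ ≤ _ := by gcongr

end OnlineGradientDescent

/-! ### Continuity of the feature map and the final statement. -/

theorem RKHS.continuous_kerFun_one {X H : Type*} [TopologicalSpace X] [NormedAddCommGroup H]
    [InnerProductSpace ℝ H] [CompleteSpace H] [RKHS ℝ H X ℝ] {K : X → X → ℝ}
    (hK : Continuous (Function.uncurry K))
    (hKH : ∀ x x' : X, RKHS.kerFun H x (1 : ℝ) x' = K x x') :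
    Continuous fun x : X => RKHS.kerFun H x (1 : ℝ) := by
  rw [continuous_iff_continuousAt]
  intro x
  rw [ContinuousAt, tendsto_iff_norm_sub_tendsto_zero]
  -- By the reproducing property, the feature distance is an explicit continuous function of the
  -- kernel.
  have hn : ∀ x', ‖RKHS.kerFun H x' (1 : ℝ) - RKHS.kerFun H x (1 : ℝ)‖ =
      √(K x' x' - 2 * K x' x + K x x) := fun x' => by
    rw [← Real.sqrt_sq (norm_nonneg (_ - _)), norm_sub_sq_real, ← real_inner_self_eq_norm_sq,
      ← real_inner_self_eq_norm_sq]
    simp only [← RKHS.apply_eq_inner, hKH]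
  simp only [hn]
  have hc : Continuous fun x' => √(K x' x' - 2 * K x' x + K x x) := by
    have h1 : Continuous fun x' => K x' x' := hK.comp (continuous_id.prodMk continuous_id)
    have h2 : Continuous fun x' => K x' x := hK.comp (continuous_id.prodMk continuous_const)
    fun_prop
  have := hc.tendsto x
  rwa [show K x x - 2 * K x x + K x x = 0 by ring, Real.sqrt_zero] at this

theorem theorem4
    {d : ℕ} {𝒳 : Set (EuclideanSpace ℝ (Fin d))} {𝒴 : Set ℝ}
    -- the probability measure on the sample space
    (ρ : Measure (𝒳 × 𝒴)) [IsProbabilityMeasure ρ]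
    -- the Mercer kernel and its reproducing kernel Hilbert space
    (K : 𝒳 → 𝒳 → ℝ) (hKcont : Continuous (Function.uncurry K))
    {H : Type*} [NormedAddCommGroup H] [InnerProductSpace ℝ H] [CompleteSpace H]
    [RKHS ℝ H 𝒳 ℝ] (hKH : ∀ x x' : 𝒳, RKHS.kerFun H x (1 : ℝ) x' = K x x')
    -- the loss
    (φ : 𝒴 → ℝ → ℝ) (α L : ℝ) (hα₀ : 0 < α) (hα₁ : α ≤ 1) (hL : 0 < L)
    (hφ : IsHolderLoss φ α L)
    -- a minimizer of the generalization error over the RKHS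
    (fH : H) (hfH : ∀ f : H, genError φ ρ fH ≤ genError φ ρ f)
    -- boundedness assumptions
    (hφ0 : BddAbove (Set.range fun y : 𝒴 => φ y 0))
    (hφH : BddAbove (Set.range fun z : 𝒳 × 𝒴 => φ z.2 (fH z.1)))
    (hκ : BddAbove (Set.range fun x : 𝒳 => √(K x x)))
    -- the i.i.d. examples
    {Ω : Type*} [MeasurableSpace Ω] (P : Measure Ω) [IsProbabilityMeasure P]
    (z : ℕ → Ω → 𝒳 × 𝒴) (hz : IsIIDSample z ρ P)
    -- the initial step size
    (η₁ : ℝ) (hη₀ : 0 < η₁) (hη₁ : η₁ * (selfBoundConst α L * kernelBound K ^ 2) ≤ 1) :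
    (∀ θ ∈ Set.Ioo (1 / (α + 1)) 1, ∀ ε > (0 : ℝ), ∀ᵐ ω ∂P,
      Tendsto (fun t : ℕ => (t : ℝ) ^ (min (1 - θ) ((α + 1) * θ - 1) - ε) *
          (genError φ ρ (onlineGD H φ (polyStep η₁ θ) (fun s => z s ω) t) - genError φ ρ fH))
        atTop (𝓝 0)) ∧
    (∀ ε > (0 : ℝ), ∀ᵐ ω ∂P,
      Tendsto (fun t : ℕ => (t : ℝ) ^ (α / (2 + α) - ε) *
          (genError φ ρ (onlineGD H φ (polyStep η₁ (2 / (2 + α))) (fun s => z s ω) t)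
            - genError φ ρ fH))
        atTop (𝓝 0)) := by
  have hK := RKHS.continuous_kerFun_one hKcont hKH
  have hκ' : ∀ x : 𝒳, ‖RKHS.kerFun H x (1 : ℝ)‖ ≤ kernelBound K := fun x => by
    rw [← Real.sqrt_sq (norm_nonneg _), ← real_inner_self_eq_norm_sq, ← RKHS.apply_eq_inner, hKH]
    exact le_ciSup hκ x
  have hκ₀ : 0 ≤ kernelBound K := Real.iSup_nonneg fun x => Real.sqrt_nonneg _
  have key := fun θ hθ ε hε => ae_tendsto_rpow_mul_excess (θ := θ) (ε := ε) hφ hα₀ hα₁ hL hφ0 hK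
    hκ' hκ₀ hz hfH hη₀ hθ hε
  refine ⟨key, fun ε hε => ?_⟩
  have hmem : 2 / (2 + α) ∈ Set.Ioo (1 / (α + 1)) 1 := by
    constructor
    · rw [div_lt_div_iff₀ (by positivity) (by positivity)]
      linarith
    · rw [div_lt_one (by positivity)]
      linarith
  -- At this `θ` the two competing exponents coincide.
  have hexp : min (1 - 2 / (2 + α)) ((α + 1) * (2 / (2 + α)) - 1) = α / (2 + α) := by
    rw [show 1 - 2 / (2 + α) = α / (2 + α) by field_simp; ring,
      show (α + 1) * (2 / (2 + α)) - 1 = α / (2 + α) by field_simp; ring, min_self]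
  have h := key _ hmem ε hε
  rwa [hexp] at h
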